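/- All vector spaces are over $\mathbb{C}$, $X'$ denotes the space of continuous linear functionals on a Hausdorff locally convex space $X$, and a Fréchet space is a complete metrizable locally convex space. A sequence of continuous linear maps $T_n\colon X\to Y_n$ ($n\in\mathbb{N}$) between Hausdorff locally convex spaces is called Eidelheit if for every $(y_n)_n\in\prod_{n\in\mathbb{N}}Y_n$ there is $x\in X$ with $T_n(x)=y_n$ for all $n\in\mathbb{N}$; a sequence $(x'_n)_n\subset X'$ is Eidelheit if this holds with $Y_n=\mathbb{C}$ and $T_n=x'_n$. For Hausdorff locally convex spaces $E$ and $F$, the $\pi$-topology on $E\otimes F$ is the finest locally convex topology for which the canonical bilinear map $E\times F\to E\otimes F$ is jointly continuous, and the $\varepsilon$-topology on $E\otimes F$ is the topology of uniform convergence on the products $A\times B$ of equicontinuous sets $A\subset E'$ and $B\subset F'$, where $x\otimes y$ is viewed as the bilinear form $(x',y')\mapsto x'(x)\,y'(y)$ on $E'\times F'$. For $t\in\{\varepsilon,\pi\}$ let $E\widehat{\otimes}_t F$ be the completion of $E\otimes F$ for the $t$-topology. If $F$ is complete and $x'\in E'$, let $x'\widehat{\otimes}_t\operatorname{Id}_F\colon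 E\widehat{\otimes}_t F\to F$ be the unique continuous linear extension of the linear map determined by $x\otimes y\mapsto x'(x)\,y$. The $F$-associated sequence of $(x'_n)_n\subset E'$ with respect to the $t$-topology is $(x'_n\widehat{\otimes}_t\operatorname{Id}_F)_n$. **Corollary 4.2.** Let $E$ and $F$ be Fréchet spaces and let $(x'_n)_n\subset E'$ be an Eidelheit sequence. Then for $t=\varepsilon$ and for $t=\pi$ the $F$-associated sequence $(x'_n\widehat{\otimes}_t\operatorname{Id}_F)_n$ with respect to the $t$-topology is Eidelheit, i.e. for every $(y_n)_n\in F^{\mathbb{N}}$ there is $\Phi\in E\widehat{\otimes}_t F$ with $(x'_n\widehat{\otimes}_t\operatorname{Id}_F)(\Phi)=y_n$ for all $n\in\mathbb{N}$. -/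

import Mathlib

open scoped TensorProduct

noncomputable section

/-- A sequence of continuous linear maps `T n : E → F n` is Eidelheit if every infinite system
`T n x = y n`, `n ∈ ℕ`, with arbitrary right-hand sides `y n ∈ F n`, has a solution `x ∈ E`. -/
def IsEidelheit {E : Type*} [AddCommGroup E] [Module ℂ E] [TopologicalSpace E]
    {F : ℕ → Type*} [∀ n, AddCommGroup (F n)] [∀ n, Module ℂ (F n)]
    [∀ n, TopologicalSpace (F n)] (T : ∀ n, E →L[ℂ] F n) : Prop :=
  ∀ y : ∀ n, F n, ∃ x : E, ∀ n, T n x = y n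

/-- The map `x' ⊗ Id_F : E ⊗ F → ℂ ⊗ F = F`, i.e. `x ⊗ y ↦ x'(x) y`. -/
def tensorId {E : Type*} [AddCommGroup E] [Module ℂ E] [TopologicalSpace E]
    (F : Type*) [AddCommGroup F] [Module ℂ F] (x' : E →L[ℂ] ℂ) : E ⊗[ℂ] F →ₗ[ℂ] F :=
  (TensorProduct.lid ℂ F).toLinearMap ∘ₗ TensorProduct.map (x' : E →ₗ[ℂ] ℂ) LinearMap.id

theorem tensorId_tmul {E : Type*} [AddCommGroup E] [Module ℂ E] [TopologicalSpace E]
    {F : Type*} [AddCommGroup F] [Module ℂ F] (x' : E →L[ℂ] ℂ) (x : E) (y : F) :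
    tensorId F x' (x ⊗ₜ[ℂ] y) = x' x • y := by
  simp [tensorId]

/-! ### The projective topology -/

/-- The topologies on `E ⊗ F` that make it a locally convex space and the canonical bilinear map
`E × F → E ⊗ F` jointly continuous. -/
def projAdmissible (E F : Type*) [AddCommGroup E] [Module ℂ E] [TopologicalSpace E]
    [AddCommGroup F] [Module ℂ F] [TopologicalSpace F] : Set (TopologicalSpace (E ⊗[ℂ] F)) :=
  {t | @IsTopologicalAddGroup _ t _ ∧ @ContinuousSMul ℂ _ _ _ t ∧
    @LocallyConvexSpace ℝ _ _ _ _ _ t ∧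
    @Continuous (E × F) (E ⊗[ℂ] F) _ t fun p => p.1 ⊗ₜ[ℂ] p.2}

/-- The `π`-topology: the finest locally convex topology on `E ⊗ F` for which the canonical
bilinear map is jointly continuous (in the order on topologies, finer means smaller). -/
@[reducible] def projTopology (E F : Type*) [AddCommGroup E] [Module ℂ E] [TopologicalSpace E]
    [AddCommGroup F] [Module ℂ F] [TopologicalSpace F] : TopologicalSpace (E ⊗[ℂ] F) :=
  sInf (projAdmissible E F)

/-- The infimum defining the `π`-topology is attained. -/
theorem projTopology_isLeast (E F : Type*) [AddCommGroup E] [Module ℂ E] [TopologicalSpace E]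
    [AddCommGroup F] [Module ℂ F] [TopologicalSpace F] :
    IsLeast (projAdmissible E F) (projTopology E F) :=
  ⟨⟨topologicalAddGroup_sInf fun _ ht => ht.1, continuousSMul_sInf fun _ ht => ht.2.1,
    LocallyConvexSpace.sInf fun _ ht => ht.2.2.1, continuous_sInf_rng.2 fun _ ht => ht.2.2.2⟩,
    fun _ ht => sInf_le ht⟩

/-- `E ⊗_π F`: the vector space `E ⊗ F` with the `π`-topology. -/
def ProjTensor (E F : Type*) [AddCommGroup E] [Module ℂ E] [AddCommGroup F] [Module ℂ F] :=
  E ⊗[ℂ] F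

/-! ### The injective topology -/

/-- An element `u` of `E ⊗ F` as a function on `E' × F'`,
`(x ⊗ y)(x', y') = x'(x) y'(y)`. -/
def tensorEval (E F : Type*) [AddCommGroup E] [Module ℂ E] [TopologicalSpace E]
    [AddCommGroup F] [Module ℂ F] [TopologicalSpace F] :
    E ⊗[ℂ] F →ₗ[ℂ] ((E →L[ℂ] ℂ) × (F →L[ℂ] ℂ) → ℂ) :=
  LinearMap.pi fun p => (TensorProduct.lid ℂ ℂ).toLinearMap ∘ₗ
    TensorProduct.map (p.1 : E →ₗ[ℂ] ℂ) (p.2 : F →ₗ[ℂ] ℂ)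

theorem tensorEval_tmul {E F : Type*} [AddCommGroup E] [Module ℂ E] [TopologicalSpace E]
    [AddCommGroup F] [Module ℂ F] [TopologicalSpace F] (x : E) (y : F)
    (p : (E →L[ℂ] ℂ) × (F →L[ℂ] ℂ)) :
    tensorEval E F (x ⊗ₜ[ℂ] y) p = p.1 x * p.2 y := by
  simp [tensorEval]

/-- Equicontinuous sets of continuous linear functionals. -/
def IsEquicontinuousSet {E : Type*} [AddCommGroup E] [Module ℂ E] [TopologicalSpace E]
    (A : Set (E →L[ℂ] ℂ)) : Prop :=
  Equicontinuous fun (f : A) (x : E) => (f : E →L[ℂ] ℂ) x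

/-- The products `A × B` of equicontinuous sets `A ⊆ E'`, `B ⊆ F'`. -/
def equicontinuousProducts (E F : Type*) [AddCommGroup E] [Module ℂ E] [TopologicalSpace E]
    [AddCommGroup F] [Module ℂ F] [TopologicalSpace F] :
    Set (Set ((E →L[ℂ] ℂ) × (F →L[ℂ] ℂ))) :=
  {S | ∃ A B, IsEquicontinuousSet A ∧ IsEquicontinuousSet B ∧ S = A ×ˢ B}

/-- The map from `E ⊗ F` to the functions on `E' × F'` with the structure of uniform convergence
on products of equicontinuous sets. -/
def tensorToUniformOnFun (E F : Type*) [AddCommGroup E] [Module ℂ E] [TopologicalSpace E]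
    [AddCommGroup F] [Module ℂ F] [TopologicalSpace F] (u : E ⊗[ℂ] F) :
    UniformOnFun ((E →L[ℂ] ℂ) × (F →L[ℂ] ℂ)) ℂ (equicontinuousProducts E F) :=
  UniformOnFun.ofFun (equicontinuousProducts E F) (tensorEval E F u)

/-- The `ε`-topology on `E ⊗ F`: uniform convergence on the products of equicontinuous subsets of
`E'` and `F'`, the elements of `E ⊗ F` being viewed as bilinear forms on `E' × F'`. -/
@[reducible] def injTopology (E F : Type*) [AddCommGroup E] [Module ℂ E] [TopologicalSpace E]
    [AddCommGroup F] [Module ℂ F] [TopologicalSpace F] : TopologicalSpace (E ⊗[ℂ] F) :=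
  TopologicalSpace.induced (tensorToUniformOnFun E F) inferInstance

/-- `E ⊗_ε F`: the vector space `E ⊗ F` with the `ε`-topology. -/
def InjTensor (E F : Type*) [AddCommGroup E] [Module ℂ E] [AddCommGroup F] [Module ℂ F] :=
  E ⊗[ℂ] F

theorem IsEquicontinuousSet.exists_bound {E : Type*} [AddCommGroup E] [Module ℂ E]
    [TopologicalSpace E] [ContinuousSMul ℂ E] {A : Set (E →L[ℂ] ℂ)} (hA : IsEquicontinuousSet A)
    (x : E) : ∃ C : ℝ, ∀ f ∈ A, ‖f x‖ ≤ C := by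
  have h0 := hA 0
  rw [Metric.equicontinuousAt_iff_right] at h0
  have h1 := h0 1 one_pos
  have h2 : Filter.Tendsto (fun c : ℂ => c • x) (nhdsWithin 0 {0}ᶜ) (nhds 0) := by
    have : Filter.Tendsto (fun c : ℂ => c • x) (nhds 0) (nhds ((0 : ℂ) • x)) :=
      (continuous_id.smul continuous_const).tendsto 0
    rw [zero_smul] at this
    exact this.mono_left nhdsWithin_le_nhds
  obtain ⟨c, hc, hc0⟩ := ((h2.eventually h1).and self_mem_nhdsWithin).exists
  refine ⟨‖c‖⁻¹, fun f hf => ?_⟩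
  have h3 := hc ⟨f, hf⟩
  have hcpos : 0 < ‖c‖ := norm_pos_iff.2 hc0
  simp only [map_zero, dist_zero_left, map_smul, norm_smul] at h3
  rw [inv_eq_one_div, le_div_iff₀ hcpos]
  linarith

section Instances

variable {E F : Type*} [AddCommGroup E] [Module ℂ E] [AddCommGroup F] [Module ℂ F]

instance : AddCommGroup (ProjTensor E F) := inferInstanceAs (AddCommGroup (E ⊗[ℂ] F))
instance : Module ℂ (ProjTensor E F) := inferInstanceAs (Module ℂ (E ⊗[ℂ] F))
instance : AddCommGroup (InjTensor E F) := inferInstanceAs (AddCommGroup (E ⊗[ℂ] F))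
instance : Module ℂ (InjTensor E F) := inferInstanceAs (Module ℂ (E ⊗[ℂ] F))

variable [TopologicalSpace E] [TopologicalSpace F]

instance : UniformSpace (ProjTensor E F) :=
  @IsTopologicalAddGroup.rightUniformSpace (E ⊗[ℂ] F) _ (projTopology E F)
    (projTopology_isLeast E F).1.1
instance : IsUniformAddGroup (ProjTensor E F) :=
  @isUniformAddGroup_of_addCommGroup (E ⊗[ℂ] F) _ (projTopology E F)
    (projTopology_isLeast E F).1.1
instance : ContinuousSMul ℂ (ProjTensor E F) := (projTopology_isLeast E F).1.2.1
instance : UniformContinuousConstSMul ℂ (ProjTensor E F) :=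
  uniformContinuousConstSMul_of_continuousConstSMul _ _

theorem injTopology_isTopologicalAddGroup :
    @IsTopologicalAddGroup (E ⊗[ℂ] F) (injTopology E F) _ :=
  topologicalAddGroup_induced
    (⟨⟨tensorToUniformOnFun E F, by simp [tensorToUniformOnFun]⟩,
      fun u v => by simp [tensorToUniformOnFun, UniformOnFun.ofFun_add]⟩ :
      E ⊗[ℂ] F →+ UniformOnFun ((E →L[ℂ] ℂ) × (F →L[ℂ] ℂ)) ℂ (equicontinuousProducts E F))

instance : UniformSpace (InjTensor E F) :=
  @IsTopologicalAddGroup.rightUniformSpace (E ⊗[ℂ] F) _ (injTopology E F)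
    injTopology_isTopologicalAddGroup
instance : IsUniformAddGroup (InjTensor E F) :=
  @isUniformAddGroup_of_addCommGroup (E ⊗[ℂ] F) _ (injTopology E F)
    injTopology_isTopologicalAddGroup

theorem tensorEval_bounded [ContinuousSMul ℂ E] [ContinuousSMul ℂ F] (u : E ⊗[ℂ] F)
    {S : Set ((E →L[ℂ] ℂ) × (F →L[ℂ] ℂ))} (hS : S ∈ equicontinuousProducts E F) :
    ∃ C : ℝ, ∀ p ∈ S, ‖tensorEval E F u p‖ ≤ C := by
  obtain ⟨A, B, hA, hB, rfl⟩ := hS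
  induction u with
  | zero => exact ⟨0, fun p _ => by simp⟩
  | tmul x y =>
    obtain ⟨C, hC⟩ := hA.exists_bound x
    obtain ⟨D, hD⟩ := hB.exists_bound y
    refine ⟨C * D, fun p hp => ?_⟩
    rw [tensorEval_tmul, norm_mul]
    exact mul_le_mul (hC _ hp.1) (hD _ hp.2) (norm_nonneg _)
      ((norm_nonneg _).trans (hC _ hp.1))
  | add u v hu hv =>
    obtain ⟨C, hC⟩ := hu
    obtain ⟨D, hD⟩ := hv
    refine ⟨C + D, fun p hp => ?_⟩
    rw [map_add]
    exact (norm_add_le _ _).trans (add_le_add (hC p hp) (hD p hp))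

instance [ContinuousSMul ℂ E] [ContinuousSMul ℂ F] : ContinuousSMul ℂ (InjTensor E F) := by
  refine UniformOnFun.continuousSMul_induced_of_image_bounded ℂ _ ℂ (InjTensor E F)
    (𝔖 := equicontinuousProducts E F) (tensorEval E F) ⟨rfl⟩ fun u s hs => ?_
  obtain ⟨C, hC⟩ := tensorEval_bounded u hs
  rw [NormedSpace.isVonNBounded_iff, isBounded_iff_forall_norm_le]
  exact ⟨C, by rintro _ ⟨p, hp, rfl⟩; exact hC p hp⟩

instance [ContinuousSMul ℂ E] [ContinuousSMul ℂ F] :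
    UniformContinuousConstSMul ℂ (InjTensor E F) :=
  uniformContinuousConstSMul_of_continuousConstSMul _ _

end Instances

/-! ### The associated sequences -/

section Associated

variable {E F : Type*} [AddCommGroup E] [Module ℂ E] [TopologicalSpace E]
  [AddCommGroup F] [Module ℂ F]

theorem continuous_tensorId_proj [TopologicalSpace F] [IsTopologicalAddGroup F]
    [ContinuousSMul ℂ F] [LocallyConvexSpace ℝ F] (x' : E →L[ℂ] ℂ) :
    @Continuous (ProjTensor E F) F _ _ (tensorId F x') := by
  refine continuous_iff_le_induced.2 ((projTopology_isLeast E F).2 ⟨?_, ?_, ?_, ?_⟩)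
  · exact topologicalAddGroup_induced (tensorId F x')
  · exact continuousSMul_induced (tensorId F x')
  · exact LocallyConvexSpace.induced ((tensorId F x').restrictScalars ℝ)
  · refine continuous_induced_rng.2 ?_
    have : Continuous fun p : E × F => x' p.1 • p.2 := by fun_prop
    refine this.congr fun p => ?_
    exact (tensorId_tmul x' p.1 p.2).symm

theorem exists_dual_eq_seminorm [TopologicalSpace F] [IsTopologicalAddGroup F]
    [ContinuousSMul ℂ F] [PolynormableSpace ℂ F] {p : Seminorm ℂ F} (hp : Continuous p) (v : F) :
    ∃ g : F →L[ℂ] ℂ, ‖g v‖ = p v ∧ ∀ y, ‖g y‖ ≤ p y := by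
  by_cases hv : v = 0
  · exact ⟨0, by simp [hv], fun y => by simp⟩
  obtain ⟨g, hg, hgp⟩ := Module.Dual.exists_continuous_extension_of_le_seminorm
    (Submodule.span ℂ {v})
    ((p v : ℂ) • (LinearEquiv.coord ℂ F v hv).toLinearMap) hp (by
      rintro ⟨x, hx⟩
      obtain ⟨c, rfl⟩ := Submodule.mem_span_singleton.1 hx
      have : (LinearEquiv.coord ℂ F v hv) ⟨c • v, hx⟩ = c := by
        have h := LinearEquiv.coord_self ℂ F v hv
        have h2 : (⟨c • v, hx⟩ : Submodule.span ℂ {v}) =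
          c • ⟨v, Submodule.mem_span_singleton_self v⟩ := rfl
        rw [h2, map_smul, h, smul_eq_mul, mul_one]
      simp [this, map_smul_eq_mul, mul_comm, abs_of_nonneg (apply_nonneg p v)])
  refine ⟨g, ?_, hgp⟩
  have h := hg ⟨v, Submodule.mem_span_singleton_self v⟩
  have h' := LinearEquiv.coord_self ℂ F v hv
  simp only [LinearMap.smul_apply, LinearEquiv.coe_coe] at h
  rw [h, h']
  simp

theorem polynormable_of_locallyConvex [TopologicalSpace F] [IsTopologicalAddGroup F]
    [ContinuousSMul ℂ F] [LocallyConvexSpace ℝ F] : PolynormableSpace ℂ F := by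
  open scoped ComplexOrder in
  have : LocallyConvexSpace ℂ F :=
    (locallyConvexSpace_iff_exists_convex_subset ℂ F).2 fun x U hU => by
      obtain ⟨S, hS, hc, hSU⟩ := (locallyConvexSpace_iff_exists_convex_subset ℝ F).1 inferInstance
        x U hU
      exact ⟨S, hS, convex_of_nonneg_surjective_algebraMap _
        (fun x hx => by simpa using! RCLike.nonneg_iff_exists_ofReal.mp hx) hc, hSU⟩
  have : ContinuousSMul ℝ F := IsScalarTower.continuousSMul ℂ
  exact LocallyConvexSpace.toPolynormableSpace

theorem dual_tensorId [TopologicalSpace F] (x' : E →L[ℂ] ℂ) (y' : F →L[ℂ] ℂ) (u : E ⊗[ℂ] F) :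
    y' (tensorId F x' u) = tensorEval E F u (x', y') := by
  induction u with
  | zero => simp
  | tmul x y => simp [tensorId_tmul, tensorEval_tmul]
  | add u v hu hv => simp [hu, hv]

theorem continuous_tensorId_inj [TopologicalSpace F] [IsTopologicalAddGroup F]
    [ContinuousSMul ℂ F] [LocallyConvexSpace ℝ F] (x' : E →L[ℂ] ℂ) :
    @Continuous (InjTensor E F) F _ _ (tensorId F x') := by
  have := polynormable_of_locallyConvex (F := F)
  refine continuous_of_continuousAt_zero
    (⟨⟨tensorId F x', map_zero _⟩, map_add _⟩ : InjTensor E F →+ F) ?_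
  change Filter.Tendsto (fun u : InjTensor E F => tensorId F x' u) (nhds 0) (nhds _)
  rw [(PolynormableSpace.withSeminorms ℂ F).tendsto_nhds]
  rintro ⟨p, hp⟩ ε hε
  let S : Set ((E →L[ℂ] ℂ) × (F →L[ℂ] ℂ)) := {x'} ×ˢ {y' | ∀ y, ‖y' y‖ ≤ p y}
  have hS : S ∈ equicontinuousProducts E F := by
    refine ⟨_, _, ?_, ?_, rfl⟩
    · intro x
      rw [Metric.equicontinuousAt_iff_right]
      intro δ hδ
      filter_upwards [Metric.tendsto_nhds.1 (x'.continuous.tendsto x) δ hδ]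
      rintro y hy ⟨f, rfl⟩
      rwa [dist_comm]
    · intro x
      rw [Metric.equicontinuousAt_iff_right]
      intro δ hδ
      have : Filter.Tendsto (fun y => p (x - y)) (nhds x) (nhds (p (x - x))) :=
        (hp.comp (continuous_const.sub continuous_id)).tendsto x
      rw [sub_self, map_zero] at this
      filter_upwards [this.eventually (gt_mem_nhds hδ)]
      rintro y hy ⟨f, hf⟩
      rw [dist_eq_norm, ← map_sub]
      exact (hf _).trans_lt hy
  have hc : @Continuous (InjTensor E F) _ _ _ (tensorToUniformOnFun E F) :=
    continuous_induced_dom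
  have h1 := UniformOnFun.tendsto_iff_tendstoUniformlyOn.1 (hc.tendsto 0) S hS
  rw [Metric.tendstoUniformlyOn_iff] at h1
  filter_upwards [h1 ε hε] with u hu
  obtain ⟨g, hg, hgp⟩ := exists_dual_eq_seminorm hp (tensorId F x' u)
  have h2 := hu (x', g) ⟨rfl, hgp⟩
  have h3 : tensorEval E F (0 : E ⊗[ℂ] F) (x', g) = 0 := by simp
  change dist (tensorEval E F (0 : E ⊗[ℂ] F) (x', g)) (tensorEval E F u (x', g)) < ε at h2
  rw [h3, dist_zero_left] at h2
  have h4 : ‖g (tensorId F x' u)‖ < ε := (congrArg norm (dual_tensorId x' g u)).trans_lt h2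
  have h5 : tensorId F x' u - tensorId F x' (0 : E ⊗[ℂ] F) = tensorId F x' u := by simp
  change p (tensorId F x' u - tensorId F x' (0 : E ⊗[ℂ] F)) < ε
  exact (congrArg p h5).trans_lt (hg.symm.trans_lt h4)

variable (F) [UniformSpace F] [IsUniformAddGroup F] [ContinuousSMul ℂ F] [LocallyConvexSpace ℝ F]

/-- `x' ⊗ Id_F` as a continuous linear map `E ⊗_π F → F`. -/
def projTensorId (x' : E →L[ℂ] ℂ) : ProjTensor E F →L[ℂ] F :=
  { toLinearMap := (tensorId F x' : E ⊗[ℂ] F →ₗ[ℂ] F), cont := continuous_tensorId_proj x' }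

/-- `x' ⊗ Id_F` as a continuous linear map `E ⊗_ε F → F`. -/
def injTensorId (x' : E →L[ℂ] ℂ) : InjTensor E F →L[ℂ] F :=
  { toLinearMap := (tensorId F x' : E ⊗[ℂ] F →ₗ[ℂ] F), cont := continuous_tensorId_inj x' }

variable [ContinuousSMul ℂ E] [T2Space F] [CompleteSpace F]

/-- The `F`-associated sequence of `x'` with respect to the `π`-topology: the continuous linear
extensions of `x' n ⊗ Id_F` to the completion of `E ⊗_π F`. -/
def projAssociated (x' : ℕ → E →L[ℂ] ℂ) :
    ℕ → UniformSpace.Completion (ProjTensor E F) →L[ℂ] F :=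
  have := uniformContinuousConstSMul_of_continuousConstSMul ℂ F
  fun n => (projTensorId F (x' n)).fromCompletion

/-- The `F`-associated sequence of `x'` with respect to the `ε`-topology: the continuous linear
extensions of `x' n ⊗ Id_F` to the completion of `E ⊗_ε F`. -/
def injAssociated (x' : ℕ → E →L[ℂ] ℂ) :
    ℕ → UniformSpace.Completion (InjTensor E F) →L[ℂ] F :=
  have := uniformContinuousConstSMul_of_continuousConstSMul ℂ F
  fun n => (injTensorId F (x' n)).fromCompletion

end Associated

end

open Filter Topology Set
open scoped Pointwise

section OpenMapping

variable {𝕜 : Type*} [NontriviallyNormedField 𝕜]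
  {E : Type*} [AddCommGroup E] [Module 𝕜 E]
  {G : Type*} [AddCommGroup G] [Module 𝕜 G] [TopologicalSpace G] [IsTopologicalAddGroup G]
  [ContinuousSMul 𝕜 G]

/-- A surjective continuous linear map onto a Baire space is almost open. -/
theorem closure_image_mem_nhds_zero [TopologicalSpace E] [IsTopologicalAddGroup E]
    [ContinuousSMul 𝕜 E] [BaireSpace G] (T : E →L[𝕜] G)
    (hT : Function.Surjective T) {U : Set E} (hU : U ∈ 𝓝 (0 : E)) :
    closure (T '' U) ∈ 𝓝 (0 : G) := by
  obtain ⟨c, hc⟩ := NormedField.exists_one_lt_norm 𝕜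
  have hc0 : c ≠ 0 := norm_pos_iff.1 (one_pos.trans hc)
  obtain ⟨V, hV, hVU⟩ : ∃ V ∈ 𝓝 (0 : E), ∀ v ∈ V, ∀ w ∈ V, v - w ∈ U := by
    have h : Tendsto (fun p : E × E => p.1 - p.2) (𝓝 0 ×ˢ 𝓝 0) (𝓝 0) := by
      have := (continuous_sub (G := E)).tendsto (0, 0)
      rwa [nhds_prod_eq, sub_zero] at this
    obtain ⟨V, hV, hV'⟩ := mem_prod_same_iff.1 (h hU)
    exact ⟨V, hV, fun v hv w hw => hV' (mk_mem_prod hv hw)⟩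
  have hcover : ⋃ n : ℕ, (c ^ n) • closure (T '' V) = univ := by
    refine eq_univ_of_forall fun y => ?_
    obtain ⟨x, rfl⟩ := hT y
    have h : Tendsto (fun n : ℕ => (c⁻¹ ^ n) • x) atTop (𝓝 0) := by
      have := (tendsto_pow_atTop_nhds_zero_of_norm_lt_one (x := c⁻¹) (by
        rw [norm_inv]; exact inv_lt_one_of_one_lt₀ hc)).smul_const x
      rwa [zero_smul] at this
    obtain ⟨n, hn⟩ := (h.eventually hV).exists
    refine mem_iUnion.2 ⟨n, (mem_smul_set_iff_inv_smul_mem₀ (pow_ne_zero n hc0) _ _).2 ?_⟩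
    refine subset_closure ⟨_, hn, ?_⟩
    rw [map_smul, inv_pow]
  obtain ⟨n, z, hz⟩ := nonempty_interior_of_iUnion_of_closed
    (fun n => isClosed_closure.smul_of_ne_zero (pow_ne_zero n hc0)) hcover
  rw [interior_smul₀ (pow_ne_zero n hc0)] at hz
  obtain ⟨z, hz, -⟩ := hz
  have hsub : ∀ a ∈ closure (T '' V), ∀ b ∈ closure (T '' V), a - b ∈ closure (T '' U) := by
    intro a ha b hb
    refine map_mem_closure₂ continuous_sub ha hb ?_
    rintro _ ⟨v, hv, rfl⟩ _ ⟨w, hw, rfl⟩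
    exact ⟨v - w, hVU v hv w hw, map_sub T v w⟩
  have h0 : Tendsto (fun y : G => y + z) (𝓝 0) (𝓝 z) := by
    have := (continuous_add_const z).tendsto (0 : G)
    rwa [zero_add] at this
  filter_upwards [h0 (mem_interior_iff_mem_nhds.1 hz)] with y hy
  simpa using hsub _ hy z (interior_subset hz)

/-- The **open mapping theorem** for complete first countable topological vector spaces. -/
theorem isOpenMap_of_surjective_of_baireSpace [UniformSpace E] [IsUniformAddGroup E]
    [ContinuousSMul 𝕜 E] [CompleteSpace E] [FirstCountableTopology E] [BaireSpace G] [T2Space G]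
    (T : E →L[𝕜] G) (hT : Function.Surjective T) : IsOpenMap T := by
  obtain ⟨u, hu, hadd⟩ := IsTopologicalAddGroup.exists_antitone_basis_nhds_zero E
  have hstep : ∀ n, ∀ y ∈ closure (T '' u n), ∃ x ∈ u n, y - T x ∈ closure (T '' u (n + 1)) := by
    intro n y hy
    have h0 : Tendsto (fun z => y - z) (𝓝 y) (𝓝 0) := by
      have := (continuous_sub_left y).tendsto y
      rwa [sub_self] at this
    obtain ⟨_, hz, x, hx, rfl⟩ := mem_closure_iff_nhds.1 hy _
      (h0 (closure_image_mem_nhds_zero T hT (hu.mem (n + 1))))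
    exact ⟨x, hx, hz⟩
  choose! g hgu hgT using hstep
  have hkey : ∀ n, closure (T '' u (n + 1)) ⊆ T '' closure (u n) := by
    intro n y hy
    let r : ℕ → G := fun k => Nat.rec y (fun k a => a - T (g (n + 1 + k) a)) k
    have hrs : ∀ k, r (k + 1) = r k - T (g (n + 1 + k) (r k)) := fun k => rfl
    have hr : ∀ k, r k ∈ closure (T '' u (n + 1 + k)) := by
      intro k
      induction k with
      | zero => exact hy
      | succ k ih => exact hgT _ _ ih
    let x : ℕ → E := fun k => g (n + 1 + k) (r k)
    have hx : ∀ k, x k ∈ u (n + 1 + k) := fun k => hgu _ _ (hr k)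
    have hsum : ∀ k m, ∑ i ∈ Finset.range k, x (m + i) ∈ u (n + m) := by
      intro k
      induction k with
      | zero => intro m; simpa using mem_of_mem_nhds (hu.mem (n + m))
      | succ k ih =>
        intro m
        rw [Finset.sum_range_succ']
        refine hadd (n + m) (add_mem_add ?_ ?_)
        · have := ih (m + 1)
          simpa only [add_assoc, add_comm 1] using this
        · have := hx m
          rwa [add_right_comm] at this
    let s : ℕ → E := fun k => ∑ i ∈ Finset.range k, x i
    have hTs : ∀ k, T (s k) = y - r k := by
      intro k
      induction k with
      | zero => simp [s, r]
      | succ k ih =>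
        have : s (k + 1) = s k + x k := Finset.sum_range_succ _ _
        rw [this, map_add, ih, hrs]
        abel
    have hcau : CauchySeq s := by
      rw [hu.1.uniformity_of_nhds_zero.cauchySeq_iff']
      have hneg : ∀ N, ∃ M, ∀ z ∈ u M, -z ∈ u N := by
        intro N
        have : Tendsto (fun z : E => -z) (𝓝 0) (𝓝 0) := by
          simpa using (continuous_neg (G := E)).tendsto 0
        obtain ⟨M, -, hM⟩ := hu.1.mem_iff.1 (this (hu.mem N))
        exact ⟨M, fun z hz => hM hz⟩
      intro N _
      obtain ⟨M, hM⟩ := hneg N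
      refine ⟨M, fun k hk => ?_⟩
      obtain ⟨k, rfl⟩ := Nat.exists_eq_add_of_le hk
      have h1 : s (M + k) = s M + ∑ i ∈ Finset.range k, x (M + i) :=
        Finset.sum_range_add _ _ _
      change s M - s (M + k) ∈ u N
      rw [h1, sub_add_cancel_left]
      exact hM _ (hu.antitone (Nat.le_add_left M n) (hsum k M))
    obtain ⟨a, ha⟩ := cauchySeq_tendsto_of_complete hcau
    have hr0 : Tendsto r atTop (𝓝 0) := by
      rw [(closed_nhds_basis (0 : G)).tendsto_right_iff]
      rintro W ⟨hW, hWc⟩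
      have hpre : T ⁻¹' W ∈ 𝓝 (0 : E) := T.continuous.continuousAt.preimage_mem_nhds
        (by rwa [map_zero])
      obtain ⟨N, -, hN⟩ := hu.1.mem_iff.1 hpre
      filter_upwards [eventually_ge_atTop N] with k hk
      refine closure_minimal ?_ hWc (hr k)
      exact image_subset_iff.2 ((hu.antitone (by omega)).trans hN)
    refine ⟨a, mem_closure_of_tendsto ha (Eventually.of_forall fun k => ?_), ?_⟩
    · simpa [s] using hsum k 0
    · have h1 := (T.continuous.tendsto a).comp ha
      have h2 : Tendsto (T ∘ s) atTop (𝓝 (y - 0)) :=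
        (tendsto_const_nhds.sub hr0).congr fun k => (hTs k).symm
      rw [sub_zero] at h2
      exact tendsto_nhds_unique h1 h2
  refine (IsTopologicalAddGroup.isOpenMap_iff_nhds_zero (f := T.toLinearMap.toAddMonoidHom)).2 ?_
  intro A hA
  obtain ⟨W, ⟨hW, hWc⟩, hWA⟩ := (closed_nhds_basis (0 : E)).mem_iff.1 (mem_map.1 hA)
  obtain ⟨N, -, hN⟩ := hu.1.mem_iff.1 hW
  refine mem_of_superset (closure_image_mem_nhds_zero T hT (hu.mem (N + 1))) ?_
  refine (hkey N).trans (image_subset_iff.2 ?_)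
  exact (closure_minimal hN hWc).trans hWA

end OpenMapping

/-- Null sequences lift along surjective open additive maps from first countable groups. -/
theorem IsOpenMap.exists_lift_tendsto_zero {E G : Type*} [AddCommGroup E] [AddCommGroup G]
    [TopologicalSpace E] [FirstCountableTopology E] [TopologicalSpace G] {T : E →+ G}
    (ho : IsOpenMap T) (hT : Function.Surjective T) {s : ℕ → G} (hs : Tendsto s atTop (𝓝 0)) :
    ∃ w : ℕ → E, (∀ n, T (w n) = s n) ∧ Tendsto w atTop (𝓝 0) := by
  obtain ⟨w, hw, hw0⟩ := LowerHemicontinuousAt.exists_seq_tendsto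
    (isOpenMap_iff_lowerHemicontinuous.1 ho 0) hs (y₀ := 0) (by simp)
  choose v hv using fun n => hT (s n)
  classical
  refine ⟨fun n => if T (w n) = s n then w n else v n, fun n => ?_, hw0.congr' ?_⟩
  · dsimp only
    split_ifs with h
    exacts [h, hv n]
  · filter_upwards [hw] with n hn
    exact (if_pos hn).symm

/-- Every sequence in a first countable topological vector space is scaled to a null sequence by
suitable nonzero scalars. -/
theorem exists_ne_zero_tendsto_smul_zero {𝕜 F : Type*} [NontriviallyNormedField 𝕜]
    [AddCommGroup F] [Module 𝕜 F]
    [TopologicalSpace F] [FirstCountableTopology F] [ContinuousSMul 𝕜 F] (y : ℕ → F) :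
    ∃ c : ℕ → 𝕜, (∀ n, c n ≠ 0) ∧ Tendsto (fun n => c n • y n) atTop (𝓝 0) := by
  obtain ⟨u, hu⟩ := (𝓝 (0 : F)).exists_antitone_basis
  have h : ∀ n, ∃ c : 𝕜, c ≠ 0 ∧ c • y n ∈ u n := by
    intro n
    have h2 : Tendsto (fun c : 𝕜 => c • y n) (𝓝[≠] 0) (𝓝 0) := by
      have : Tendsto (fun c : 𝕜 => c • y n) (𝓝 0) (𝓝 ((0 : 𝕜) • y n)) :=
        (continuous_id.smul continuous_const).tendsto 0
      rw [zero_smul] at this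
      exact this.mono_left nhdsWithin_le_nhds
    obtain ⟨c, hc, hc0⟩ := ((h2.eventually (hu.mem n)).and self_mem_nhdsWithin).exists
    exact ⟨c, hc0, hc⟩
  choose c hc0 hc using h
  exact ⟨c, hc0, hu.tendsto hc⟩

/-- In a locally convex space the series `∑ 2⁻ⁿ z n` is Cauchy for every null sequence `z`. -/
theorem cauchySeq_sum_geometric_smul {G : Type*} [AddCommGroup G] [Module ℂ G] [UniformSpace G]
    [IsUniformAddGroup G] [ContinuousSMul ℂ G] [LocallyConvexSpace ℝ G] {z : ℕ → G}
    (hz : Tendsto z atTop (𝓝 0)) :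
    CauchySeq fun N => ∑ n ∈ Finset.range N, ((2 : ℂ)⁻¹ ^ n) • z n := by
  have := polynormable_of_locallyConvex (F := G)
  have hb := (PolynormableSpace.withSeminorms ℂ G).hasBasis_zero_ball
  rw [hb.uniformity_of_nhds_zero.cauchySeq_iff']
  rintro ⟨t, r⟩ hr
  set q : Seminorm ℂ G := t.sup fun p : {p : Seminorm ℂ G // Continuous p} => p.1
  have hq : ∀ᶠ n in atTop, q (z n) < 1 := by
    filter_upwards [hz.eventually (hb.mem_of_mem (i := (t, 1)) one_pos)] with n hn
    simpa [Seminorm.mem_ball_zero] using hn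
  have hsmall : ∀ᶠ n : ℕ in atTop, 2 * (2 : ℝ)⁻¹ ^ n < r := by
    have := (tendsto_pow_atTop_nhds_zero_of_lt_one (r := (2 : ℝ)⁻¹) (by norm_num)
      (by norm_num)).const_mul 2
    rw [mul_zero] at this
    exact this.eventually (gt_mem_nhds hr)
  obtain ⟨N, hN⟩ := eventually_atTop.1 hq
  obtain ⟨M, hM, hNM⟩ := (hsmall.and (eventually_ge_atTop N)).exists
  refine ⟨M, fun k hk => ?_⟩
  obtain ⟨k, rfl⟩ := Nat.exists_eq_add_of_le hk
  have hbound : q (∑ i ∈ Finset.range k, ((2 : ℂ)⁻¹ ^ (M + i)) • z (M + i)) ≤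
      2 * (2 : ℝ)⁻¹ ^ M - 2 * (2 : ℝ)⁻¹ ^ (M + k) := by
    induction k with
    | zero => simp
    | succ k ih =>
      rw [Finset.sum_range_succ]
      refine (map_add_le_add q _ _).trans ?_
      have h1 : q (((2 : ℂ)⁻¹ ^ (M + k)) • z (M + k)) ≤ (2 : ℝ)⁻¹ ^ (M + k) := by
        rw [map_smul_eq_mul, norm_pow, norm_inv, Complex.norm_ofNat]
        exact mul_le_of_le_one_right (by positivity) (hN _ (by omega)).le
      have h2 := ih (by omega)
      have h3 : (2 : ℝ)⁻¹ ^ (M + (k + 1)) = (2 : ℝ)⁻¹ ^ (M + k) * 2⁻¹ := pow_succ _ _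
      linarith
  rw [Finset.sum_range_add]
  change _ - _ ∈ q.ball 0 r
  rw [sub_add_cancel_left, Seminorm.mem_ball_zero, map_neg_eq_map]
  have : 0 < (2 : ℝ)⁻¹ ^ (M + k) := by positivity
  linarith

theorem UniformFun.locallyConvexSpace (S : Type*) : LocallyConvexSpace ℝ (UniformFun S ℂ) := by
  refine LocallyConvexSpace.ofBasisZero ℝ _ _ _ (UniformFun.hasBasis_nhds_zero_of_basis
    (LocallyConvexSpace.convex_basis_zero ℝ ℂ)) fun V hV => ?_
  intro f hf g hg a b ha hb hab x
  exact hV.2 (hf x) (hg x) ha hb hab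

section TensorTopologies

variable {E F : Type*} [AddCommGroup E] [Module ℂ E] [TopologicalSpace E]
  [AddCommGroup F] [Module ℂ F] [TopologicalSpace F]

instance ProjTensor.locallyConvexSpace : LocallyConvexSpace ℝ (ProjTensor E F) :=
  (projTopology_isLeast E F).1.2.2.1

instance InjTensor.locallyConvexSpace : LocallyConvexSpace ℝ (InjTensor E F) := by
  have hU (S : Set ((E →L[ℂ] ℂ) × (F →L[ℂ] ℂ))) := UniformFun.locallyConvexSpace S
  have h : injTopology E F = ⨅ S ∈ equicontinuousProducts E F,
      TopologicalSpace.induced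
        (fun u : E ⊗[ℂ] F => UniformFun.ofFun (S.domRestrict (tensorEval E F u)))
        inferInstance := by
    simp only [injTopology, UniformOnFun.topologicalSpace_eq, induced_iInf, induced_compose]
    rfl
  change @LocallyConvexSpace ℝ (E ⊗[ℂ] F) _ _ _ _ (injTopology E F)
  rw [h]
  refine LocallyConvexSpace.iInf fun S => LocallyConvexSpace.iInf fun _ => ?_
  let f : E ⊗[ℂ] F →ₗ[ℂ] UniformFun S ℂ :=
    { toFun := fun u => UniformFun.ofFun (S.domRestrict (tensorEval E F u))
      map_add' := fun u v => by rw [map_add]; rfl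
      map_smul' := fun c u => by rw [map_smul]; rfl }
  exact LocallyConvexSpace.induced (𝕜 := ℝ) (F := UniformFun S ℂ) (f.restrictScalars ℝ)

theorem ProjTensor.tendsto_tmul_zero {w : ℕ → E} {v : ℕ → F} (hw : Tendsto w atTop (𝓝 0))
    (hv : Tendsto v atTop (𝓝 0)) :
    Tendsto (β := ProjTensor E F) (fun n => w n ⊗ₜ[ℂ] v n) atTop (𝓝 0) := by
  have h : Continuous (Y := ProjTensor E F) fun p : E × F => p.1 ⊗ₜ[ℂ] p.2 :=
    (projTopology_isLeast E F).1.2.2.2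
  have h1 := (h.tendsto (0, 0)).comp (hw.prodMk_nhds hv)
  rwa [TensorProduct.zero_tmul] at h1

theorem IsEquicontinuousSet.eventually_norm_lt {A : Set (E →L[ℂ] ℂ)} (hA : IsEquicontinuousSet A)
    {w : ℕ → E} (hw : Tendsto w atTop (𝓝 0)) {ε : ℝ} (hε : 0 < ε) :
    ∀ᶠ n in atTop, ∀ f ∈ A, ‖f (w n)‖ < ε := by
  filter_upwards [hw.eventually (Metric.equicontinuousAt_iff_right.1 (hA 0) ε hε)] with n hn f hf
  simpa using hn ⟨f, hf⟩

theorem InjTensor.tendsto_tmul_zero {w : ℕ → E} {v : ℕ → F} (hw : Tendsto w atTop (𝓝 0))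
    (hv : Tendsto v atTop (𝓝 0)) :
    Tendsto (β := InjTensor E F) (fun n => w n ⊗ₜ[ℂ] v n) atTop (𝓝 0) := by
  have hind : IsInducing (X := InjTensor E F) (tensorToUniformOnFun E F) := ⟨rfl⟩
  refine hind.tendsto_nhds_iff.2 (UniformOnFun.tendsto_iff_tendstoUniformlyOn.2 ?_)
  rintro _ ⟨A, B, hA, hB, rfl⟩
  rw [Metric.tendstoUniformlyOn_iff]
  intro ε hε
  filter_upwards [hA.eventually_norm_lt hw one_pos, hB.eventually_norm_lt hv hε]
    with n hn hn' p hp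
  change dist (tensorEval E F (0 : E ⊗[ℂ] F) p) (tensorEval E F (w n ⊗ₜ[ℂ] v n) p) < ε
  rw [map_zero, Pi.zero_apply, dist_zero_left, tensorEval_tmul, norm_mul]
  have h1 := hn _ hp.1
  have h2 := hn' _ hp.2
  exact (mul_le_of_le_one_left (norm_nonneg _) h1.le).trans_lt h2

end TensorTopologies

/-- A null sequence `z` in `G` whose weighted images under the maps `f m` are `y m` at the index
`m` and `0` elsewhere yields a common solution of `f m Φ = y m` in the completion of `G`. -/
theorem exists_fromCompletion_eq {G F : Type*} [AddCommGroup G] [Module ℂ G] [UniformSpace G]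
    [IsUniformAddGroup G] [ContinuousSMul ℂ G] [UniformContinuousConstSMul ℂ G]
    [LocallyConvexSpace ℝ G] [AddCommGroup F] [Module ℂ F] [UniformSpace F] [IsUniformAddGroup F]
    [UniformContinuousConstSMul ℂ F] [T2Space F] [CompleteSpace F] (f : ℕ → G →L[ℂ] F)
    {y : ℕ → F} {z : ℕ → G} (hz : Tendsto z atTop (𝓝 0))
    (hf : ∀ m n, f m (((2 : ℂ)⁻¹ ^ n) • z n) = if m = n then y n else 0) :
    ∃ Φ : UniformSpace.Completion G, ∀ m, (f m).fromCompletion Φ = y m := by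
  have hc := (cauchySeq_sum_geometric_smul hz).map
    (UniformSpace.Completion.uniformContinuous_coe G)
  obtain ⟨Φ, hΦ⟩ := cauchySeq_tendsto_of_complete hc
  refine ⟨Φ, fun m => ?_⟩
  refine tendsto_nhds_unique (((f m).fromCompletion.continuous.tendsto Φ).comp hΦ) ?_
  refine tendsto_const_nhds.congr' ?_
  filter_upwards [eventually_gt_atTop m] with N hN
  simp only [Function.comp_apply, ContinuousLinearMap.fromCompletion_apply_coe]
  rw [map_sum, Finset.sum_congr rfl fun n _ => hf m n]
  simp [hN]

/-- For an Eidelheit sequence on a Fréchet space and any scalars `a n` there is a null sequence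
`w` such that `w n` solves the system with right-hand side `a n` at the index `n` and `0`
elsewhere. -/
theorem IsEidelheit.exists_null_sequence {E : Type*} [AddCommGroup E] [Module ℂ E]
    [UniformSpace E] [IsUniformAddGroup E] [ContinuousSMul ℂ E] [FirstCountableTopology E]
    [CompleteSpace E] {x' : ℕ → E →L[ℂ] ℂ} (hx' : IsEidelheit x') (a : ℕ → ℂ) :
    ∃ w : ℕ → E, (∀ m n, x' m (w n) = if m = n then a n else 0) ∧ Tendsto w atTop (𝓝 0) := by
  let T : E →L[ℂ] (ℕ → ℂ) := ContinuousLinearMap.pi x'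
  have hT : Function.Surjective T := fun y => by
    obtain ⟨x, hx⟩ := hx' y
    exact ⟨x, funext hx⟩
  have hs : Tendsto (fun n => (Pi.single n (a n) : ℕ → ℂ)) atTop (𝓝 0) := by
    refine tendsto_pi_nhds.2 fun m => tendsto_const_nhds.congr' ?_
    filter_upwards [eventually_gt_atTop m] with n hn
    rw [Pi.single_eq_of_ne hn.ne, Pi.zero_apply]
  obtain ⟨w, hw, hw0⟩ := IsOpenMap.exists_lift_tendsto_zero (T := T.toLinearMap.toAddMonoidHom)
    (isOpenMap_of_surjective_of_baireSpace T hT) hT hs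
  refine ⟨w, fun m n => ?_, hw0⟩
  have := congrFun (hw n) m
  rwa [Pi.single_apply] at this

/-- For Fréchet spaces `E` and `F` (complete metrizable locally convex spaces over `ℂ`), the
`F`-associated sequence of an Eidelheit sequence in `E'` is Eidelheit, both for the `ε`-topology
and for the `π`-topology. -/
theorem corollary4p2
    (E : Type*) [AddCommGroup E] [Module ℂ E] [UniformSpace E] [IsUniformAddGroup E]
    [ContinuousSMul ℂ E] [LocallyConvexSpace ℝ E] [TopologicalSpace.MetrizableSpace E]
    [CompleteSpace E]
    (F : Type*) [AddCommGroup F] [Module ℂ F] [UniformSpace F] [IsUniformAddGroup F]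
    [ContinuousSMul ℂ F] [LocallyConvexSpace ℝ F] [TopologicalSpace.MetrizableSpace F]
    [CompleteSpace F]
    (x' : ℕ → E →L[ℂ] ℂ) (hx' : IsEidelheit x') :
    IsEidelheit (injAssociated F x') ∧ IsEidelheit (projAssociated F x') := by 
  have := uniformContinuousConstSMul_of_continuousConstSMul ℂ F
  have key : ∀ y : ℕ → F, ∃ (w : ℕ → E) (v : ℕ → F), Tendsto w atTop (𝓝 0) ∧
      Tendsto v atTop (𝓝 0) ∧ ∀ m n, tensorId F (x' m) (((2 : ℂ)⁻¹ ^ n) • w n ⊗ₜ[ℂ] v n) =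
        if m = n then y n else 0 := by
    intro y
    obtain ⟨c, hc, hcy⟩ := exists_ne_zero_tendsto_smul_zero (𝕜 := ℂ) y
    obtain ⟨w, hw, hw0⟩ := hx'.exists_null_sequence fun n => 2 ^ n * (c n)⁻¹
    refine ⟨w, _, hw0, hcy, fun m n => ?_⟩
    rw [map_smul, tensorId_tmul, hw]
    split_ifs
    · rw [smul_smul, smul_smul, inv_pow, inv_mul_cancel_left₀ (pow_ne_zero n two_ne_zero),
        inv_mul_cancel₀ (hc n), one_smul]
    · rw [zero_smul, smul_zero]
  refine ⟨fun y => ?_, fun y => ?_⟩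
  · obtain ⟨w, v, hw, hv, h⟩ := key y
    exact exists_fromCompletion_eq (fun n => injTensorId F (x' n))
      (InjTensor.tendsto_tmul_zero hw hv) h
  · obtain ⟨w, v, hw, hv, h⟩ := key y
    exact exists_fromCompletion_eq (fun n => projTensorId F (x' n))
      (ProjTensor.tendsto_tmul_zero hw hv) h
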